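/- Let $\mathbb{D}$ be the open unit disk in $\mathbb{C}$ and $\mathbb{T}=\partial\mathbb{D}$. Let $\varphi$ be a holomorphic function on $\mathbb{D}^2$ with $|\varphi|\le 1$ (a two-variable Schur function). Write $\pi^1(\lambda,\mu)=\lambda$, $\pi^2(\lambda,\mu)=\mu$ for the coordinate projections on $\mathbb{D}^2$, $\varphi_\mu(\lambda)=\varphi(\lambda,\mu)$ for the slices of $\varphi$, and $\widetilde\varphi(\lambda,\mu)=\varphi(\mu,\lambda)$. If $f:\mathbb{D}\to\mathbb{D}$ is holomorphic without fixed points, its Denjoy–Wolff point is the point $\tau\in\mathbb{T}$ to which the iterates of $f$ converge uniformly on compact subsets of $\mathbb{D}$; the Denjoy–Wolff point of a unimodular constant function $f\equiv\tau$ on $\mathbb{D}$ is understood to be $\tau$. The function $\varphi$ is called left Type I if $\varphi\neq\pi^1$ and some $\tau^1\in\mathbb{T}$ is the Denjoy–Wolff point of $\varphi_\mu$ for every $\mu\in\mathbb{D}$. It is called left Type II if $\varphi\neq\pi^1$ and there is a holomorphic map $\xi:\mathbb{D}\to\mathbb{D}$ such that, for all $\lambda,\mu\in\mathbb{D}$,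 $\varphi_\mu(\lambda)=\lambda$ if and only if $\lambda=\xi(\mu)$. It is called right Type I (respectively right Type II) if $\widetilde\varphi$ is left Type I (respectively left Type II). **Theorem 4.3.** If $\varphi\neq\pi^1$, then $\varphi$ is either left Type I or left Type II, but not both. If $\varphi\neq\pi^2$, then $\varphi$ is either right Type I or right Type II, but not both. -/

import Mathlib

open Set Filter

/-- The open unit disk `𝔻`. -/
abbrev disk : Set ℂ := Metric.ball 0 1

/-- The bidisk `𝔻²`. -/
abbrev bidisk : Set (ℂ × ℂ) := disk ×ˢ disk

/-- The two-variable Schur class: analytic functions on `𝔻²` bounded by `1` in modulus.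
Only the values of `φ` on the bidisk matter; unimodular constants are included. -/
structure IsSchur₂ (φ : ℂ × ℂ → ℂ) : Prop where
  differentiableOn : DifferentiableOn ℂ φ bidisk
  norm_le_one : ∀ p ∈ bidisk, ‖φ p‖ ≤ 1

/-- The slice function `φ_μ(l) = φ(l, μ)`. -/
def slice (φ : ℂ × ℂ → ℂ) (μ : ℂ) : ℂ → ℂ := fun l => φ (l, μ)

/-- The function `φ` with its two arguments interchanged. -/
def swapArgs (φ : ℂ × ℂ → ℂ) : ℂ × ℂ → ℂ := fun p => φ (p.2, p.1)

/-- `φ = π¹` as functions on the bidisk. -/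
def IsProjFst (φ : ℂ × ℂ → ℂ) : Prop := ∀ p ∈ bidisk, φ p = p.1

/-- `φ = π²` as functions on the bidisk. -/
def IsProjSnd (φ : ℂ × ℂ → ℂ) : Prop := ∀ p ∈ bidisk, φ p = p.2

/-- `τ` is the Denjoy–Wolff point, lying on the unit circle, of the one-variable Schur
function `f`: either `f` maps the disk into itself without fixed points and the iterates of `f`
converge to `τ` uniformly on compact subsets of the disk, or (the degenerate case of a Schur
function that is not a self-map of the disk) `f` is the unimodular constant `τ`. -/
def IsBoundaryDenjoyWolffPoint (f : ℂ → ℂ) (τ : ℂ) : Prop :=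
  ‖τ‖ = 1 ∧
    ((MapsTo f disk disk ∧ (∀ z ∈ disk, f z ≠ z) ∧
        ∀ K : Set ℂ, K ⊆ disk → IsCompact K →
          TendstoUniformlyOn (fun (n : ℕ) (z : ℂ) => f^[n] z) (fun _ => τ) atTop K) ∨
      ∀ z ∈ disk, f z = τ)

/-- Left Type I: `φ ≠ π¹` and all slices `φ_μ` have a common Denjoy–Wolff point on the circle. -/
def IsLeftTypeI (φ : ℂ × ℂ → ℂ) : Prop :=
  ¬ IsProjFst φ ∧ ∃ τ : ℂ, ‖τ‖ = 1 ∧ ∀ μ ∈ disk, IsBoundaryDenjoyWolffPoint (slice φ μ) τ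

/-- Left Type II: `φ ≠ π¹` and there is a holomorphic `ξ : 𝔻 → 𝔻` such that, for all `l, μ` in
the disk, `φ_μ(l) = l` if and only if `ξ(μ) = l`. -/
def IsLeftTypeII (φ : ℂ × ℂ → ℂ) : Prop :=
  ¬ IsProjFst φ ∧ ∃ ξ : ℂ → ℂ, DifferentiableOn ℂ ξ disk ∧ MapsTo ξ disk disk ∧
    ∀ l ∈ disk, ∀ μ ∈ disk, slice φ μ l = l ↔ ξ μ = l

/-- Right Type I: the function with interchanged arguments is left Type I. -/
def IsRightTypeI (φ : ℂ × ℂ → ℂ) : Prop := IsLeftTypeI (swapArgs φ)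

/-- Right Type II: the function with interchanged arguments is left Type II. -/
def IsRightTypeII (φ : ℂ × ℂ → ℂ) : Prop := IsLeftTypeII (swapArgs φ)

open Complex Topology ComplexConjugate

/-! For `r < 1`, the map `r φ_μ` strictly contracts the hyperbolic geometry of the disk, so
iterating it from `0` gives a fixed point `ξ_r(μ)`, holomorphic in `μ`. The dichotomy comes from
letting `r → 1`.

If some slice has a fixed point `l₀` in the disk, `norm_scaled_fixed_le` confines the approximations
at that parameter to `|z| ≤ |l₀|`. Schwarz-Pick in `μ` then keeps every subsequential limit at the
other parameters off the circle, so all slices have fixed points. These are unique unless `φ = π¹`;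
hence the `ξ_r` converge, and the limit is holomorphic: Type II.

If no slice has a fixed point, limits lie on the circle and do not depend on `μ` (`limit_eq`).
Schwarz-Pick for `φ_μ` passes to the limit as Julia's inequality at the common point `τ`, from which
the Denjoy-Wolff convergence follows: Type I. -/

/-! ### Schwarz-Pick theory in one variable. -/

/-- A one-variable Schur function: holomorphic on the disk and bounded by `1` in modulus. -/
structure IsSchur (f : ℂ → ℂ) : Prop where
  differentiableOn : DifferentiableOn ℂ f disk
  norm_le_one : ∀ z ∈ disk, ‖f z‖ ≤ 1

theorem mem_disk {z : ℂ} : z ∈ disk ↔ ‖z‖ < 1 := by simp [disk]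

theorem one_sub_normSq_pos {z : ℂ} (hz : z ∈ disk) : 0 < 1 - ‖z‖ ^ 2 := by
  have := mem_disk.1 hz
  nlinarith [norm_nonneg z]

theorem norm_one_sub_conj_mul_sq (a z : ℂ) :
    ‖1 - conj a * z‖ ^ 2 = ‖z - a‖ ^ 2 + (1 - ‖a‖ ^ 2) * (1 - ‖z‖ ^ 2) := by
  simp only [← Complex.normSq_eq_norm_sq, Complex.normSq_apply]
  simp
  ring

theorem one_sub_conj_mul_ne_zero {a z : ℂ} (ha : a ∈ disk) (hz : z ∈ disk) :
    1 - conj a * z ≠ 0 := by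
  intro h
  have h1 := norm_one_sub_conj_mul_sq a z
  rw [h] at h1
  have := mul_pos (one_sub_normSq_pos ha) (one_sub_normSq_pos hz)
  simp at h1
  nlinarith [sq_nonneg ‖z - a‖]

/-- The disk automorphism interchanging the roles of `a` and `0`. -/
noncomputable def mobius (a z : ℂ) : ℂ := (z - a) / (1 - conj a * z)

theorem norm_mobius_sq {a z : ℂ} :
    ‖mobius a z‖ ^ 2 = ‖z - a‖ ^ 2 / (‖z - a‖ ^ 2 + (1 - ‖a‖ ^ 2) * (1 - ‖z‖ ^ 2)) := by
  rw [mobius, norm_div, div_pow, norm_one_sub_conj_mul_sq]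

theorem mobius_mem_disk {a z : ℂ} (ha : a ∈ disk) (hz : z ∈ disk) : mobius a z ∈ disk := by
  have h := mul_pos (one_sub_normSq_pos ha) (one_sub_normSq_pos hz)
  have : ‖mobius a z‖ ^ 2 < 1 := by
    rw [norm_mobius_sq, div_lt_one (by positivity)]
    linarith
  rw [mem_disk]
  nlinarith [norm_nonneg (mobius a z)]

theorem differentiableOn_mobius {a : ℂ} (ha : a ∈ disk) :
    DifferentiableOn ℂ (mobius a) disk := by
  unfold mobius
  exact DifferentiableOn.div (by fun_prop) (by fun_prop)
    fun z hz => one_sub_conj_mul_ne_zero ha hz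

theorem neg_mem_disk {a : ℂ} (ha : a ∈ disk) : -a ∈ disk := by simpa [disk] using ha

theorem zero_mem_disk : (0 : ℂ) ∈ disk := by simp [disk]

theorem mobius_neg_mobius {a z : ℂ} (ha : a ∈ disk) (hz : z ∈ disk) :
    mobius (-a) (mobius a z) = z := by
  have h1 := one_sub_conj_mul_ne_zero ha hz
  have h2 := one_sub_conj_mul_ne_zero ha ha
  simp only [mobius, map_neg]
  generalize conj a = c at *
  have h3 : 1 - -c * ((z - a) / (1 - c * z)) = (1 - c * a) / (1 - c * z) := by
    rw [eq_div_iff h1, sub_mul, one_mul, mul_assoc, div_mul_cancel₀ _ h1]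
    ring
  have h4 : (z - a) / (1 - c * z) - -a = z * (1 - c * a) / (1 - c * z) := by
    rw [eq_div_iff h1, sub_mul, div_mul_cancel₀ _ h1]
    ring
  rw [h3, h4, div_div_div_cancel_right₀ h1, mul_div_cancel_right₀ _ h2]

@[simp] theorem mobius_self (a : ℂ) : mobius a a = 0 := by simp [mobius]

@[simp] theorem mobius_zero_right (a : ℂ) : mobius a 0 = -a := by simp [mobius]

theorem isSchur_mobius_comp {f : ℂ → ℂ} (hf : DifferentiableOn ℂ f disk)
    (hm : MapsTo f disk disk) {a b : ℂ} (ha : a ∈ disk) (hb : b ∈ disk) :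
    DifferentiableOn ℂ (fun z => mobius b (f (mobius (-a) z))) disk ∧
      MapsTo (fun z => mobius b (f (mobius (-a) z))) disk disk := by
  have hM : MapsTo (mobius (-a)) disk disk := fun z hz => mobius_mem_disk (neg_mem_disk ha) hz
  exact ⟨(differentiableOn_mobius hb).comp
    (hf.comp (differentiableOn_mobius (neg_mem_disk ha)) hM) (hm.comp hM),
    fun z hz => mobius_mem_disk hb (hm (hM hz))⟩

/-- A Schur function attaining modulus one is constant. -/
theorem IsSchur.eqOn_const {f : ℂ → ℂ} (hf : IsSchur f) {c : ℂ} (hc : c ∈ disk)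
    (h : ‖f c‖ = 1) {z : ℂ} (hz : z ∈ disk) : f z = f c :=
  Complex.eqOn_of_isPreconnected_of_isMaxOn_norm (convex_ball 0 1).isPreconnected
    Metric.isOpen_ball hf.differentiableOn hc
    (fun w hw => by simpa [h] using hf.norm_le_one w hw) hz

theorem IsSchur.mapsTo_or_const {f : ℂ → ℂ} (hf : IsSchur f) :
    MapsTo f disk disk ∨ ∃ τ : ℂ, ‖τ‖ = 1 ∧ ∀ z ∈ disk, f z = τ := by
  by_cases h : MapsTo f disk disk
  · exact Or.inl h
  · simp only [MapsTo, not_forall, mem_disk, not_lt] at h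
    obtain ⟨c, hc, h1⟩ := h
    rw [← mem_disk] at hc
    have h2 := le_antisymm (hf.norm_le_one c hc) h1
    exact Or.inr ⟨f c, h2, fun z hz => hf.eqOn_const hc h2 hz⟩

theorem schwarz_pick_of_mapsTo {f : ℂ → ℂ} (hf : DifferentiableOn ℂ f disk)
    (hm : MapsTo f disk disk) {a b : ℂ} (ha : a ∈ disk) (hb : b ∈ disk) :
    ‖mobius (f a) (f b)‖ ≤ ‖mobius a b‖ := by
  obtain ⟨h1, h2⟩ := isSchur_mobius_comp hf hm ha (hm ha)
  have := Complex.norm_le_norm_of_mapsTo_ball h1 (h2.mono_right Metric.ball_subset_closedBall)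
    (by simp) (mem_disk.1 (mobius_mem_disk ha hb))
  simpa [mobius_neg_mobius ha hb] using this

/-- The Schwarz-Pick inequality. -/
theorem IsSchur.schwarz_pick {f : ℂ → ℂ} (hf : IsSchur f) {a b : ℂ} (ha : a ∈ disk)
    (hb : b ∈ disk) :
    ‖f a - f b‖ ^ 2 * ((1 - ‖a‖ ^ 2) * (1 - ‖b‖ ^ 2)) ≤
      ‖a - b‖ ^ 2 * ((1 - ‖f a‖ ^ 2) * (1 - ‖f b‖ ^ 2)) := by
  rcases hf.mapsTo_or_const with hm | ⟨τ, hτ, h⟩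
  · have h1 := schwarz_pick_of_mapsTo hf.differentiableOn hm ha hb
    have h2 : ‖mobius (f a) (f b)‖ ^ 2 ≤ ‖mobius a b‖ ^ 2 := by gcongr
    have p1 := mul_pos (one_sub_normSq_pos ha) (one_sub_normSq_pos hb)
    have p2 := mul_pos (one_sub_normSq_pos (hm ha)) (one_sub_normSq_pos (hm hb))
    rw [norm_mobius_sq, norm_mobius_sq, div_le_div_iff₀ (by positivity) (by positivity)] at h2
    rw [norm_sub_rev (f a), norm_sub_rev a]
    linarith
  · simp [h a ha, h b hb, hτ]

/-- Moving `a` to `0` turns `b` into a nonzero fixed point, the equality case of the Schwarz lemma: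
the conjugated map is linear with slope `1`. -/
theorem eqOn_id_of_two_fixed {f : ℂ → ℂ} (hf : DifferentiableOn ℂ f disk)
    (hm : MapsTo f disk disk) {a b : ℂ} (ha : a ∈ disk) (hb : b ∈ disk) (hab : a ≠ b)
    (hfa : f a = a) (hfb : f b = b) {z : ℂ} (hz : z ∈ disk) : f z = z := by
  obtain ⟨h1, h2⟩ := isSchur_mobius_comp hf hm ha ha
  set g := fun z => mobius a (f (mobius (-a) z)) with hg
  have g0 : g 0 = 0 := by simp [hg, hfa]
  have gu : g (mobius a b) = mobius a b := by simp [hg, mobius_neg_mobius ha hb, hfb]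
  have hu := mobius_mem_disk ha hb
  have hu0 : mobius a b ≠ 0 := by
    rw [mobius, Ne, div_eq_zero_iff, not_or]
    exact ⟨sub_ne_zero.2 hab.symm, one_sub_conj_mul_ne_zero ha hb⟩
  have hs : dslope g 0 (mobius a b) = 1 := by
    rw [dslope_of_ne _ hu0, slope_def_field, gu, g0, div_self (by simpa using hu0)]
  have key := Complex.affine_of_mapsTo_ball_of_norm_dslope_eq_div (R₂ := 1) h1
    (by rw [g0]; exact h2.mono_right Metric.ball_subset_closedBall) hu (by simp [hs])
  have k := key (mobius_mem_disk ha hz)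
  have k2 : g (mobius a z) = mobius a z := by simpa [hs, g0] using k
  simp only [hg, mobius_neg_mobius ha hz] at k2
  rw [← mobius_neg_mobius ha (hm hz), k2, mobius_neg_mobius ha hz]

theorem IsSchur.norm_sub_le {f : ℂ → ℂ} (hf : IsSchur f) {a b : ℂ} (ha : a ∈ disk)
    (hb : b ∈ disk) :
    ‖f a - f b‖ ≤ √(‖a - b‖ ^ 2 / ((1 - ‖a‖ ^ 2) * (1 - ‖b‖ ^ 2))) := by
  have h := hf.schwarz_pick ha hb
  have p := mul_pos (one_sub_normSq_pos ha) (one_sub_normSq_pos hb)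
  apply Real.le_sqrt_of_sq_le
  rw [le_div_iff₀ p]
  refine h.trans (mul_le_of_le_one_right (by positivity) ?_)
  have h1 := hf.norm_le_one a ha
  have h2 := hf.norm_le_one b hb
  have h3 : ‖f a‖ ^ 2 ≤ 1 := pow_le_one₀ (norm_nonneg _) h1
  have h4 : ‖f b‖ ^ 2 ≤ 1 := pow_le_one₀ (norm_nonneg _) h2
  nlinarith [sq_nonneg ‖f a‖, sq_nonneg ‖f b‖]

/-! ### Limits of Schur functions. -/

/-- Pointwise convergence of Schur functions is locally uniform. -/
theorem tendstoLocallyUniformlyOn_of_isSchur {F : ℕ → ℂ → ℂ} {f : ℂ → ℂ}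
    (hF : ∀ n, IsSchur (F n)) (h : ∀ z ∈ disk, Tendsto (fun n => F n z) atTop (𝓝 (f z))) :
    TendstoLocallyUniformlyOn F f atTop disk := by
  rw [IsOpen.tendstoLocallyUniformlyOn_iff_forall_tendsto Metric.isOpen_ball]
  intro x hx
  rw [tendsto_uniformity_iff_dist_tendsto_zero]
  set C : ℂ → ℝ := fun y => √(‖x - y‖ ^ 2 / ((1 - ‖x‖ ^ 2) * (1 - ‖y‖ ^ 2))) with hC
  have hC0 : Tendsto C (𝓝 x) (𝓝 0) := by
    have p := one_sub_normSq_pos hx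
    have : ContinuousAt C x := by
      apply ContinuousAt.sqrt
      apply ContinuousAt.div (by fun_prop) (by fun_prop)
      positivity
    simpa [hC] using this.tendsto
  -- The modulus `C` is independent of `n`, so it survives the pointwise limit, and `f` needs no
  -- prior continuity.
  have hf : ∀ y ∈ disk, ‖f x - f y‖ ≤ C y := fun y hy =>
    le_of_tendsto ((h x hx).sub (h y hy)).norm
      (Eventually.of_forall fun n => (hF n).norm_sub_le hx hy)
  have hlim : Tendsto (fun y : ℕ × ℂ => C y.2 + ‖f x - F y.1 x‖ + C y.2)
      (atTop ×ˢ 𝓝 x) (𝓝 0) := by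
    have h1 := hC0.comp (tendsto_snd (f := (atTop : Filter ℕ)) (g := 𝓝 x))
    have h2 := ((tendsto_const_nhds (x := f x)).sub (h x hx)).norm.comp
      (tendsto_fst (f := (atTop : Filter ℕ)) (g := 𝓝 x))
    simpa [Function.comp_def] using (h1.add h2).add h1
  refine squeeze_zero' (Eventually.of_forall fun _ => dist_nonneg) ?_ hlim
  have hev : ∀ᶠ y : ℕ × ℂ in atTop ×ˢ 𝓝 x, y.2 ∈ disk :=
    tendsto_snd.eventually (Metric.isOpen_ball.mem_nhds hx)
  filter_upwards [hev] with y hy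
  have e1 := hf y.2 hy
  have e2 := (hF y.1).norm_sub_le hx hy
  rw [dist_eq_norm]
  calc ‖f y.2 - F y.1 y.2‖
      = ‖-(f x - f y.2) + (f x - F y.1 x) + (F y.1 x - F y.1 y.2)‖ := by congr 1; ring
    _ ≤ ‖-(f x - f y.2)‖ + ‖f x - F y.1 x‖ + ‖F y.1 x - F y.1 y.2‖ := norm_add₃_le
    _ ≤ _ := by rw [norm_neg]; gcongr

theorem isSchur_of_tendsto {F : ℕ → ℂ → ℂ} {f : ℂ → ℂ}
    (hF : ∀ n, IsSchur (F n)) (h : ∀ z ∈ disk, Tendsto (fun n => F n z) atTop (𝓝 (f z))) :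
    IsSchur f :=
  ⟨(tendstoLocallyUniformlyOn_of_isSchur hF h).differentiableOn
    (Eventually.of_forall fun n => (hF n).differentiableOn) Metric.isOpen_ball,
    fun z hz => le_of_tendsto (h z hz).norm
      (Eventually.of_forall fun n => (hF n).norm_le_one z hz)⟩

theorem IsCompact.tendsto_of_subseq_unique {X : Type*} [TopologicalSpace X]
    [FirstCountableTopology X] {K : Set X} (hK : IsCompact K) {u : ℕ → X} {x : X}
    (hu : ∀ n, u n ∈ K)
    (h : ∀ a ∈ K, ∀ ψ : ℕ → ℕ, StrictMono ψ → Tendsto (u ∘ ψ) atTop (𝓝 a) → a = x) :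
    Tendsto u atTop (𝓝 x) := by
  refine hK.tendsto_nhds_of_unique_mapClusterPt (Eventually.of_forall hu) fun a ha hc => ?_
  obtain ⟨ψ, hψ, hlim⟩ := hc.tendsto_subseq
  exact h a ha ψ hψ hlim

/-! ### Denjoy-Wolff convergence from Julia's inequality. -/

/-- The Cayley transform sending the disk to the right half-plane and `τ` to infinity. -/
noncomputable def cayley (τ z : ℂ) : ℂ := (τ + z) / (τ - z)

theorem sub_ne_zero_of_mem_disk {τ z : ℂ} (hτ : ‖τ‖ = 1) (hz : z ∈ disk) : τ - z ≠ 0 := by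
  intro h
  rw [mem_disk, ← sub_eq_zero.1 h, hτ] at hz
  exact lt_irrefl _ hz

theorem cayley_re {τ z : ℂ} (hτ : ‖τ‖ = 1) :
    (cayley τ z).re = (1 - ‖z‖ ^ 2) / ‖τ - z‖ ^ 2 := by
  have h : (1 : ℝ) = ‖τ‖ ^ 2 := by simp [hτ]
  rw [cayley, Complex.div_re, ← add_div, h]
  simp only [← Complex.normSq_eq_norm_sq]
  congr 1
  simp only [Complex.normSq_apply, add_re, add_im, sub_re, sub_im]
  ring

theorem differentiableOn_cayley {τ : ℂ} (hτ : ‖τ‖ = 1) :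
    DifferentiableOn ℂ (cayley τ) disk := by
  unfold cayley
  exact DifferentiableOn.div (by fun_prop) (by fun_prop)
    fun z hz => sub_ne_zero_of_mem_disk hτ hz

theorem cayley_re_pos {τ z : ℂ} (hτ : ‖τ‖ = 1) (hz : z ∈ disk) : 0 < (cayley τ z).re := by
  rw [cayley_re hτ]
  have := norm_pos_iff.2 (sub_ne_zero_of_mem_disk hτ hz)
  exact div_pos (one_sub_normSq_pos hz) (by positivity)

theorem cayley_injOn {τ : ℂ} (hτ : ‖τ‖ = 1) : InjOn (cayley τ) disk := by
  intro z hz w hw h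
  have h1 := sub_ne_zero_of_mem_disk hτ hz
  have h2 := sub_ne_zero_of_mem_disk hτ hw
  have h0 : τ ≠ 0 := by rintro rfl; simp at hτ
  simp only [cayley] at h
  rw [div_eq_div_iff h1 h2] at h
  have : 2 * τ * (z - w) = 0 := by linear_combination h
  simpa [h0, sub_eq_zero] using this

/-- A holomorphic function on the disk with nonnegative real part is constant or has positive
real part. -/
theorem const_or_re_pos {p : ℂ → ℂ} (hp : DifferentiableOn ℂ p disk)
    (h : ∀ z ∈ disk, 0 ≤ (p z).re) :
    (∃ c, ∀ z ∈ disk, p z = c) ∨ ∀ z ∈ disk, 0 < (p z).re := by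
  refine ((hp.analyticOnNhd Metric.isOpen_ball).is_constant_or_isOpen
    (convex_ball 0 1).isPreconnected).imp id fun ho z hz => ?_
  have h1 := ho disk Subset.rfl Metric.isOpen_ball
  have h2 : p '' disk ⊆ {z : ℂ | 0 ≤ z.re} := by
    rintro _ ⟨z, hz, rfl⟩
    exact h z hz
  have h3 := interior_maximal h2 h1 (mem_image_of_mem p hz)
  rwa [Complex.interior_setOfPred_le_re] at h3

theorem isSchur_iterate {f : ℂ → ℂ} (hf : DifferentiableOn ℂ f disk) (hm : MapsTo f disk disk)
    (n : ℕ) : IsSchur f^[n] := by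
  refine ⟨?_, fun z hz => (mem_disk.1 (hm.iterate n hz)).le⟩
  induction n with
  | zero => exact differentiableOn_id
  | succ n ih =>
    rw [Function.iterate_succ]
    exact ih.comp hf hm

theorem tendsto_iterate_of_drift {f : ℂ → ℂ} (hm : MapsTo f disk disk) {τ c : ℂ}
    (hτ : ‖τ‖ = 1) (hc : c ≠ 0) (h : ∀ z ∈ disk, cayley τ (f z) = cayley τ z + c)
    {z : ℂ} (hz : z ∈ disk) : Tendsto (fun n => f^[n] z) atTop (𝓝 τ) := by
  have hmn : ∀ n, f^[n] z ∈ disk := fun n => hm.iterate n hz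
  have h1 : ∀ n : ℕ, cayley τ (f^[n] z) = cayley τ z + n * c := by
    intro n
    induction n with
    | zero => simp
    | succ n ih =>
      rw [Function.iterate_succ_apply', h _ (hmn n), ih]
      push_cast
      ring
  have hlim : Tendsto (fun n : ℕ => 2 / ((n : ℝ) * ‖c‖ - ‖cayley τ z‖)) atTop (𝓝 0) := by
    apply Tendsto.const_div_atTop
    exact tendsto_atTop_add_const_right _ _
      (tendsto_natCast_atTop_atTop.atTop_mul_const (norm_pos_iff.2 hc))
  rw [tendsto_iff_norm_sub_tendsto_zero]
  refine squeeze_zero' (Eventually.of_forall fun _ => norm_nonneg _) ?_ hlim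
  have hev : ∀ᶠ n : ℕ in atTop, ‖cayley τ z‖ < (n : ℝ) * ‖c‖ :=
    (tendsto_natCast_atTop_atTop.atTop_mul_const (norm_pos_iff.2 hc)).eventually_gt_atTop _
  filter_upwards [hev] with n hn
  have h2 : (n : ℝ) * ‖c‖ - ‖cayley τ z‖ ≤ ‖cayley τ (f^[n] z)‖ := by
    rw [h1, add_comm]
    have := norm_sub_norm_le ((n : ℂ) * c) (-cayley τ z)
    simpa using this
  have h3 : ‖cayley τ (f^[n] z)‖ * ‖τ - f^[n] z‖ ≤ 2 := by
    rw [← norm_mul, cayley, div_mul_cancel₀ _ (sub_ne_zero_of_mem_disk hτ (hmn n))]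
    have := norm_add_le τ (f^[n] z)
    have := mem_disk.1 (hmn n)
    linarith
  rw [norm_sub_rev, le_div_iff₀ (by linarith), mul_comm]
  exact (mul_le_mul_of_nonneg_right h2 (norm_nonneg _)).trans h3

theorem tendsto_iterate_of_re_lt {f : ℂ → ℂ} (hf : DifferentiableOn ℂ f disk)
    (hm : MapsTo f disk disk) {τ : ℂ} (hτ : ‖τ‖ = 1)
    (h : ∀ z ∈ disk, (cayley τ z).re < (cayley τ (f z)).re)
    {z : ℂ} (hz : z ∈ disk) : Tendsto (fun n => f^[n] z) atTop (𝓝 τ) := by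
  have hmn : ∀ n, f^[n] z ∈ disk := fun n => hm.iterate n hz
  have hmono : Monotone fun n => (cayley τ (f^[n] z)).re := by
    refine monotone_nat_of_le_succ fun n => ?_
    rw [Function.iterate_succ_apply']
    exact (h _ (hmn n)).le
  refine (isCompact_closedBall (0 : ℂ) 1).tendsto_of_subseq_unique
    (fun n => Metric.ball_subset_closedBall (hmn n)) fun a ha ψ hψ hlim => ?_
  by_cases hd : a ∈ disk
  · exfalso
    have hcR : ∀ b ∈ disk, ContinuousAt (fun z => (cayley τ z).re) b := fun b hb =>
      Complex.continuous_re.continuousAt.comp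
        ((differentiableOn_cayley hτ).continuousOn.continuousAt (Metric.isOpen_ball.mem_nhds hb))
    have hcf := hf.continuousOn.continuousAt (Metric.isOpen_ball.mem_nhds hd)
    -- Since `ψ n + 1 ≤ ψ (n + 1)`, monotonicity along the orbit gives `Re (cayley τ (f a)) ≤ Re
    -- (cayley τ a)`, against strict increase at `a`.
    have l1 : Tendsto (fun n => (cayley τ (f^[ψ (n + 1)] z)).re) atTop
        (𝓝 (cayley τ a).re) :=
      ((hcR a hd).tendsto.comp hlim).comp (tendsto_add_atTop_nat 1)
    have l2 : Tendsto (fun n => (cayley τ (f (f^[ψ n] z))).re) atTop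
        (𝓝 (cayley τ (f a)).re) :=
      (hcR _ (hm hd)).tendsto.comp (hcf.tendsto.comp hlim)
    refine (h a hd).not_ge (le_of_tendsto_of_tendsto' l2 l1 fun n => ?_)
    rw [← Function.iterate_succ_apply' f]
    exact hmono (Nat.succ_le_of_lt (hψ (Nat.lt_succ_self n)))
  · have hna : ‖a‖ = 1 := le_antisymm (by simpa using ha) (by simpa [disk] using hd)
    -- The orbit stays in a horodisk at `τ`, whose closure meets the circle only at `τ`.
    have h1 : ∀ n, (cayley τ z).re * ‖τ - f^[n] z‖ ^ 2 ≤ 1 - ‖f^[n] z‖ ^ 2 := by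
      intro n
      have h2 : (cayley τ z).re ≤ (cayley τ (f^[n] z)).re := hmono (Nat.zero_le n)
      have hpos := norm_pos_iff.2 (sub_ne_zero_of_mem_disk hτ (hmn n))
      rwa [cayley_re hτ (z := f^[n] z), le_div_iff₀ (by positivity)] at h2
    have h2 : (cayley τ z).re * ‖τ - a‖ ^ 2 ≤ 1 - ‖a‖ ^ 2 :=
      le_of_tendsto_of_tendsto' (((hlim.const_sub τ).norm.pow 2).const_mul _)
        ((hlim.norm.pow 2).const_sub 1) fun n => h1 (ψ n)
    rw [hna] at h2
    have h3 := cayley_re_pos hτ hz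
    have h4 : ‖τ - a‖ ^ 2 ≤ 0 := by nlinarith
    have h5 : ‖τ - a‖ = 0 := pow_eq_zero_iff two_ne_zero |>.1 (le_antisymm h4 (sq_nonneg _))
    exact (sub_eq_zero.1 (norm_eq_zero.1 h5)).symm

/-- The Denjoy-Wolff theorem for a map satisfying the Julia inequality at `τ`. -/
theorem isBoundaryDenjoyWolffPoint_of_julia {f : ℂ → ℂ} (hf : DifferentiableOn ℂ f disk)
    (hm : MapsTo f disk disk) (hfix : ∀ z ∈ disk, f z ≠ z) {τ : ℂ} (hτ : ‖τ‖ = 1)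
    (hJ : ∀ z ∈ disk, ‖τ - f z‖ ^ 2 * (1 - ‖z‖ ^ 2) ≤ ‖τ - z‖ ^ 2 * (1 - ‖f z‖ ^ 2)) :
    IsBoundaryDenjoyWolffPoint f τ := by
  refine ⟨hτ, Or.inl ⟨hm, hfix, fun K hK hKc => ?_⟩⟩
  refine (tendstoLocallyUniformlyOn_iff_tendstoUniformlyOn_of_compact hKc).1
    ((tendstoLocallyUniformlyOn_of_isSchur (isSchur_iterate hf hm) ?_).mono hK)
  have hw := differentiableOn_cayley hτ
  have hp : DifferentiableOn ℂ (fun z => cayley τ (f z) - cayley τ z) disk :=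
    (hw.comp hf hm).sub hw
  -- In the half-plane, Julia's inequality says that `f` does not decrease the real part.
  have hre : ∀ z ∈ disk, 0 ≤ (cayley τ (f z) - cayley τ z).re := by
    intro z hz
    have h1 := norm_pos_iff.2 (sub_ne_zero_of_mem_disk hτ hz)
    have h2 := norm_pos_iff.2 (sub_ne_zero_of_mem_disk hτ (hm hz))
    rw [Complex.sub_re, cayley_re hτ, cayley_re hτ, sub_nonneg,
      div_le_div_iff₀ (by positivity) (by positivity)]
    linarith [hJ z hz]
  rcases const_or_re_pos hp hre with ⟨c, hc⟩ | hpos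
  · intro z hz
    refine tendsto_iterate_of_drift hm hτ (c := c) ?_
      (fun z hz => by rw [← hc z hz]; ring) hz
    rintro rfl
    exact hfix 0 zero_mem_disk (cayley_injOn hτ (hm zero_mem_disk) zero_mem_disk
      (sub_eq_zero.1 (hc 0 zero_mem_disk)))
  · exact fun z hz => tendsto_iterate_of_re_lt hf hm hτ
      (fun z hz => by simpa using hpos z hz) hz

/-! ### Slices of two-variable Schur functions. -/

theorem IsSchur₂.comp {φ : ℂ × ℂ → ℂ} (hφ : IsSchur₂ φ) {g h : ℂ → ℂ}
    (hg : DifferentiableOn ℂ g disk) (hgm : MapsTo g disk disk)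
    (hh : DifferentiableOn ℂ h disk) (hhm : MapsTo h disk disk) :
    IsSchur fun z => φ (g z, h z) :=
  ⟨hφ.differentiableOn.comp (hg.prodMk hh) fun _ hz => ⟨hgm hz, hhm hz⟩,
    fun _ hz => hφ.norm_le_one _ ⟨hgm hz, hhm hz⟩⟩

theorem IsSchur₂.slice {φ : ℂ × ℂ → ℂ} (hφ : IsSchur₂ φ) {μ : ℂ} (hμ : μ ∈ disk) :
    IsSchur (slice φ μ) :=
  hφ.comp differentiableOn_id (mapsTo_id _) (differentiableOn_const μ) fun _ _ => hμ

theorem IsSchur₂.slice_fst {φ : ℂ × ℂ → ℂ} (hφ : IsSchur₂ φ) {l : ℂ} (hl : l ∈ disk) :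
    IsSchur fun μ => φ (l, μ) :=
  hφ.comp (differentiableOn_const l) (fun _ _ => hl) differentiableOn_id (mapsTo_id _)

theorem IsSchur₂.swapArgs {φ : ℂ × ℂ → ℂ} (hφ : IsSchur₂ φ) : IsSchur₂ (swapArgs φ) :=
  ⟨hφ.differentiableOn.comp (by fun_prop) fun _ hp => ⟨hp.2, hp.1⟩,
    fun _ hp => hφ.norm_le_one _ ⟨hp.2, hp.1⟩⟩

theorem isProjFst_swapArgs {φ : ℂ × ℂ → ℂ} : IsProjFst (swapArgs φ) ↔ IsProjSnd φ :=
  ⟨fun h p hp => h (p.2, p.1) ⟨hp.2, hp.1⟩, fun h p hp => h (p.2, p.1) ⟨hp.2, hp.1⟩⟩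

/-- If one slice of a two-variable Schur function is the identity, then so are all slices. -/
theorem IsSchur₂.isProjFst_of_slice_eq_id {φ : ℂ × ℂ → ℂ} (hφ : IsSchur₂ φ) {μ₀ : ℂ}
    (hμ₀ : μ₀ ∈ disk) (h : ∀ l ∈ disk, φ (l, μ₀) = l) : IsProjFst φ := by
  rintro ⟨l, μ⟩ ⟨hl, hμ⟩
  simp only at hl hμ ⊢
  have hK := mul_pos (one_sub_normSq_pos hμ) (one_sub_normSq_pos hμ₀)
  set K := (1 - ‖μ‖ ^ 2) * (1 - ‖μ₀‖ ^ 2)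
  -- Schwarz-Pick in the second variable compares `φ (z, μ)` with `φ (z, μ₀) = z`; the bound
  -- vanishes as `|z| → 1`, and the maximum principle carries this inside.
  have hbd : ∀ z ∈ disk, ‖φ (z, μ) - z‖ ≤ √(‖μ - μ₀‖ ^ 2 * (1 - ‖z‖ ^ 2) / K) := by
    intro z hz
    have h1 := (hφ.slice_fst hz).schwarz_pick hμ hμ₀
    simp only [h z hz] at h1
    apply Real.le_sqrt_of_sq_le
    rw [le_div_iff₀ hK]
    refine h1.trans (mul_le_mul_of_nonneg_left ?_ (sq_nonneg _))
    have := one_sub_normSq_pos hz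
    nlinarith [mul_nonneg (sq_nonneg ‖φ (z, μ)‖) this.le]
  have hR : ∀ R ∈ Ioo ‖l‖ 1, ‖φ (l, μ) - l‖ ≤ √(‖μ - μ₀‖ ^ 2 * (1 - R ^ 2) / K) := by
    intro R hR
    have hR0 : 0 < R := (norm_nonneg l).trans_lt hR.1
    have hsub : closure (Metric.ball (0 : ℂ) R) ⊆ disk := by
      rw [closure_ball _ hR0.ne']
      exact Metric.closedBall_subset_ball hR.2
    have hd : DifferentiableOn ℂ (fun z => φ (z, μ) - z) disk :=
      (hφ.slice hμ).differentiableOn.sub differentiableOn_id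
    refine Complex.norm_le_of_forall_mem_frontier_norm_le (U := Metric.ball (0 : ℂ) R)
      Metric.isBounded_ball (hd.mono hsub).diffContOnCl ?_
      (subset_closure (by simpa using hR.1))
    intro z hz
    have hz' := hsub (frontier_subset_closure hz)
    rw [frontier_ball _ hR0.ne', mem_sphere_zero_iff_norm] at hz
    simpa [hz] using hbd z hz'
  have hlim : Tendsto (fun R : ℝ => √(‖μ - μ₀‖ ^ 2 * (1 - R ^ 2) / K)) (𝓝[<] 1) (𝓝 0) := by
    have : Continuous fun R : ℝ => √(‖μ - μ₀‖ ^ 2 * (1 - R ^ 2) / K) := by fun_prop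
    simpa using (this.tendsto 1).mono_left nhdsWithin_le_nhds
  have h0 := ge_of_tendsto hlim
    (eventually_of_mem (Ioo_mem_nhdsLT (mem_disk.1 hl)) hR)
  exact sub_eq_zero.1 (norm_le_zero_iff.1 h0)

/-! ### Fixed points of the scaled slices. -/

theorem real_mul_mem_disk {r : ℝ} (h0 : 0 ≤ r) (h1 : r < 1) {z : ℂ} (hz : ‖z‖ ≤ 1) :
    (r : ℂ) * z ∈ disk := by
  rw [mem_disk, norm_mul, Complex.norm_of_nonneg h0]
  nlinarith [norm_nonneg z]

/-- A scaled Schur function contracts the quantity controlled by the Schwarz-Pick inequality. -/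
theorem IsSchur.schwarz_pick_smul {f : ℂ → ℂ} (hf : IsSchur f) {r : ℝ} (h0 : 0 ≤ r) (h1 : r < 1)
    {a b : ℂ} (ha : a ∈ disk) (hb : b ∈ disk) :
    ‖r * f a - r * f b‖ ^ 2 / ((1 - ‖r * f a‖ ^ 2) * (1 - ‖r * f b‖ ^ 2)) ≤
      r ^ 2 * (‖a - b‖ ^ 2 / ((1 - ‖a‖ ^ 2) * (1 - ‖b‖ ^ 2))) := by
  have h := hf.schwarz_pick ha hb
  have na := hf.norm_le_one a ha
  have nb := hf.norm_le_one b hb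
  have p := mul_pos (one_sub_normSq_pos ha) (one_sub_normSq_pos hb)
  have q := mul_pos (one_sub_normSq_pos (real_mul_mem_disk h0 h1 na))
    (one_sub_normSq_pos (real_mul_mem_disk h0 h1 nb))
  have hr : ∀ x : ℂ, ‖x‖ ≤ 1 → 0 ≤ 1 - ‖x‖ ^ 2 ∧ 1 - ‖x‖ ^ 2 ≤ 1 - ‖r * x‖ ^ 2 := by
    intro x hx
    rw [norm_mul, Complex.norm_of_nonneg h0, mul_pow]
    have : ‖x‖ ^ 2 ≤ 1 := pow_le_one₀ (norm_nonneg _) hx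
    have : r ^ 2 ≤ 1 := pow_le_one₀ h0 h1.le
    constructor <;> nlinarith [sq_nonneg ‖x‖]
  rw [← mul_div_assoc, div_le_div_iff₀ q p, ← mul_sub, norm_mul, Complex.norm_of_nonneg h0,
    mul_pow, mul_assoc, mul_assoc]
  refine mul_le_mul_of_nonneg_left (h.trans ?_) (sq_nonneg r)
  exact mul_le_mul_of_nonneg_left
    (mul_le_mul (hr _ na).2 (hr _ nb).2 (hr _ nb).1 ((hr _ na).1.trans (hr _ na).2))
    (sq_nonneg _)

theorem norm_sub_sq_le_div {a b : ℂ} (ha : a ∈ disk) (hb : b ∈ disk) :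
    ‖a - b‖ ^ 2 ≤ ‖a - b‖ ^ 2 / ((1 - ‖a‖ ^ 2) * (1 - ‖b‖ ^ 2)) := by
  have ha' := one_sub_normSq_pos ha
  have hb' := one_sub_normSq_pos hb
  rw [le_div_iff₀ (by positivity)]
  refine mul_le_of_le_one_right (by positivity) ?_
  nlinarith [sq_nonneg ‖a‖, sq_nonneg ‖b‖]

/-- The orbit of `0` under a strictly scaled Schur function converges. -/
theorem IsSchur.cauchySeq_orbit {f : ℂ → ℂ} (hf : IsSchur f) {r : ℝ} (h0 : 0 ≤ r) (h1 : r < 1)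
    {x : ℕ → ℂ} (hx : ∀ n, x n ∈ disk) (hs : ∀ n, x (n + 1) = r * f (x n)) : CauchySeq x := by
  -- `Q n` is `ρ² / (1 - ρ²)` for the pseudo-hyperbolic distance `ρ` of consecutive points. It
  -- shrinks by `r²` at each step and dominates the squared Euclidean distance.
  set Q : ℕ → ℝ := fun n =>
    ‖x n - x (n + 1)‖ ^ 2 / ((1 - ‖x n‖ ^ 2) * (1 - ‖x (n + 1)‖ ^ 2)) with hQ
  have hQs : ∀ n, Q n ≤ (r ^ n) ^ 2 * Q 0 := by
    intro n
    induction n with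
    | zero => simp
    | succ n ih =>
      have := hf.schwarz_pick_smul h0 h1 (hx n) (hx (n + 1))
      rw [← hs, ← hs] at this
      calc Q (n + 1) ≤ r ^ 2 * Q n := this
        _ ≤ r ^ 2 * ((r ^ n) ^ 2 * Q 0) := by gcongr
        _ = _ := by ring
  refine cauchySeq_of_le_geometric r (√(Q 0)) h1 fun n => ?_
  rw [dist_eq_norm]
  have h2 : ‖x n - x (n + 1)‖ ^ 2 ≤ (r ^ n) ^ 2 * Q 0 :=
    (norm_sub_sq_le_div (hx n) (hx (n + 1))).trans (hQs n)
  have h3 := Real.le_sqrt_of_sq_le h2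
  rwa [Real.sqrt_mul (sq_nonneg _), Real.sqrt_sq (pow_nonneg h0 n), mul_comm] at h3

/-- The iterates of the maps `r φ_μ` on `0`, as functions of `μ`. -/
noncomputable def scaledOrbit (φ : ℂ × ℂ → ℂ) (r : ℝ) : ℕ → ℂ → ℂ
  | 0 => fun _ => 0
  | n + 1 => fun μ => r * φ (scaledOrbit φ r n μ, μ)

/-- The uniform bound `r < 1` allows each iterate to be substituted into `φ`, and keeps the limit in
the open disk. -/
theorem isSchur_scaledOrbit {φ : ℂ × ℂ → ℂ} (hφ : IsSchur₂ φ) {r : ℝ} (h0 : 0 ≤ r)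
    (h1 : r < 1) (n : ℕ) :
    IsSchur (scaledOrbit φ r n) ∧ ∀ μ ∈ disk, ‖scaledOrbit φ r n μ‖ ≤ r := by
  induction n with
  | zero => exact ⟨⟨differentiableOn_const 0, by simp [scaledOrbit]⟩, by simp [scaledOrbit, h0]⟩
  | succ n ih =>
    have hc := hφ.comp ih.1.differentiableOn (fun μ hμ => mem_disk.2 ((ih.2 μ hμ).trans_lt h1))
      differentiableOn_id (mapsTo_id _)
    have hb : ∀ μ ∈ disk, ‖scaledOrbit φ r (n + 1) μ‖ ≤ r := by
      intro μ hμ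
      simp only [scaledOrbit, norm_mul, Complex.norm_of_nonneg h0]
      exact mul_le_of_le_one_right h0 (hc.norm_le_one μ hμ)
    exact ⟨⟨hc.differentiableOn.const_mul _, fun μ hμ => (hb μ hμ).trans h1.le⟩, hb⟩

/-- The maps `r φ_μ`, with `r < 1`, have fixed points depending holomorphically on `μ`. -/
theorem IsSchur₂.exists_scaled_fixed {φ : ℂ × ℂ → ℂ} (hφ : IsSchur₂ φ) {r : ℝ} (h0 : 0 ≤ r)
    (h1 : r < 1) : ∃ ξ : ℂ → ℂ, IsSchur ξ ∧
      ∀ μ ∈ disk, ξ μ ∈ disk ∧ r * φ (ξ μ, μ) = ξ μ := by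
  have hS := isSchur_scaledOrbit hφ h0 h1
  have hex : ∀ μ ∈ disk, ∃ l, Tendsto (fun n => scaledOrbit φ r n μ) atTop (𝓝 l) :=
    fun μ hμ => cauchySeq_tendsto_of_complete <|
      (hφ.slice hμ).cauchySeq_orbit h0 h1
        (fun n => mem_disk.2 (((hS n).2 μ hμ).trans_lt h1)) fun n => rfl
  choose! ξ hξ using hex
  refine ⟨ξ, isSchur_of_tendsto (fun n => (hS n).1) hξ, fun μ hμ => ?_⟩
  have hd : ξ μ ∈ disk := mem_disk.2 <|
    (le_of_tendsto (hξ μ hμ).norm (Eventually.of_forall fun n => (hS n).2 μ hμ)).trans_lt h1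
  have hc := (hφ.slice hμ).differentiableOn.continuousOn.continuousAt
    (Metric.isOpen_ball.mem_nhds hd)
  exact ⟨hd, tendsto_nhds_unique ((hc.tendsto.comp (hξ μ hμ)).const_mul (r : ℂ))
    ((hξ μ hμ).comp (tendsto_add_atTop_nat 1))⟩

/-- Fixed points of scaled Schur functions do not lie further out than those of the function. -/
theorem IsSchur.norm_scaled_fixed_le {f : ℂ → ℂ} (hf : IsSchur f) {l w : ℂ} (hl : l ∈ disk)
    (hfl : f l = l) (hw : w ∈ disk) {r : ℝ} (h0 : 0 < r) (h1 : r < 1) (hfw : r * f w = w) :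
    ‖w‖ ≤ ‖l‖ := by
  by_contra! hlt
  have hsp := hf.schwarz_pick hw hl
  have hlp := one_sub_normSq_pos hl
  have hwp := one_sub_normSq_pos hw
  have hn : ‖w‖ = r * ‖f w‖ := by
    conv_lhs => rw [← hfw]
    rw [norm_mul, Complex.norm_of_nonneg h0.le]
  set u := f w with hu
  rw [hfl] at hsp
  have hre : (u * conj l).re ≤ ‖u‖ * ‖l‖ := by
    simpa using Complex.re_le_norm (u * conj l)
  have e1 : ‖u - l‖ ^ 2 = ‖u‖ ^ 2 + ‖l‖ ^ 2 - 2 * (u * conj l).re := by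
    simp only [← Complex.normSq_eq_norm_sq, Complex.normSq_sub]
  have e2 : ‖w - l‖ ^ 2 = r ^ 2 * ‖u‖ ^ 2 + ‖l‖ ^ 2 - 2 * (r * (u * conj l).re) := by
    rw [← Complex.normSq_eq_norm_sq, Complex.normSq_sub, Complex.normSq_eq_norm_sq,
      Complex.normSq_eq_norm_sq, hn, ← hfw, mul_assoc, Complex.re_ofReal_mul]
    ring
  have hupos : 0 < ‖u‖ := by
    have := (norm_nonneg l).trans_lt hlt
    rw [hn] at this
    exact pos_of_mul_pos_right this h0.le
  -- As `w = r u` and `|l| < |w|`, moving from `w` out to `u` increases the distance to `l`; with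
  -- `|w| ≤ |u|` this contradicts Schwarz-Pick for `f`, which fixes `l`.
  have hfar : ‖w - l‖ ^ 2 < ‖u - l‖ ^ 2 := by
    have h2 : ‖u‖ * ‖l‖ ≤ ‖u‖ * (r * ‖u‖) := by rw [← hn]; gcongr
    have h3 : 0 < (1 - r) * ((1 + r) * ‖u‖ ^ 2 - 2 * (u * conj l).re) := by
      refine mul_pos (by linarith) ?_
      have : 0 < (1 - r) * ‖u‖ ^ 2 := mul_pos (by linarith) (by positivity)
      nlinarith
    nlinarith
  have hwu : ‖w‖ ^ 2 ≤ ‖u‖ ^ 2 := by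
    have : ‖w‖ ≤ ‖u‖ := by rw [hn]; exact mul_le_of_le_one_left hupos.le h1.le
    gcongr
  have h4 : ‖w - l‖ ^ 2 * ((1 - ‖u‖ ^ 2) * (1 - ‖l‖ ^ 2)) ≤
      ‖w - l‖ ^ 2 * ((1 - ‖w‖ ^ 2) * (1 - ‖l‖ ^ 2)) := by gcongr
  have h5 := mul_lt_mul_of_pos_right hfar (mul_pos hwp hlp)
  linarith

/-! ### Limits of the approximate fixed points. -/

/-- A holomorphic choice of fixed points of `r n • φ_μ` along scalars `r n < 1` tending to `1`. -/
structure IsApproxFixed (φ : ℂ × ℂ → ℂ) (r : ℕ → ℝ) (ξ : ℕ → ℂ → ℂ) : Prop where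
  mem_Ioo : ∀ n, r n ∈ Ioo 0 1
  tendsto_one : Tendsto r atTop (𝓝 1)
  isSchur : ∀ n, IsSchur (ξ n)
  mem_disk : ∀ n, ∀ μ ∈ disk, ξ n μ ∈ disk
  scaled_eq : ∀ n, ∀ μ ∈ disk, r n * φ (ξ n μ, μ) = ξ n μ

theorem IsSchur₂.exists_isApproxFixed {φ : ℂ × ℂ → ℂ} (hφ : IsSchur₂ φ) :
    ∃ r ξ, IsApproxFixed φ r ξ := by
  obtain ⟨r, -, hr, hlim⟩ := exists_seq_strictMono_tendsto' (zero_lt_one (α := ℝ))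
  choose ξ h1 h2 using fun n => hφ.exists_scaled_fixed (hr n).1.le (hr n).2
  exact ⟨r, ξ, hr, hlim, h1, fun n μ hμ => (h2 n μ hμ).1, fun n μ hμ => (h2 n μ hμ).2⟩

namespace IsApproxFixed

variable {φ : ℂ × ℂ → ℂ} {r : ℕ → ℝ} {ξ : ℕ → ℂ → ℂ}

theorem comp (h : IsApproxFixed φ r ξ) {ψ : ℕ → ℕ} (hψ : StrictMono ψ) :
    IsApproxFixed φ (r ∘ ψ) (ξ ∘ ψ) :=
  ⟨fun _ => h.mem_Ioo _, h.tendsto_one.comp hψ.tendsto_atTop, fun _ => h.isSchur _,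
    fun _ => h.mem_disk _, fun _ => h.scaled_eq _⟩

theorem mem_closedBall (h : IsApproxFixed φ r ξ) {μ : ℂ} (hμ : μ ∈ disk) (n : ℕ) :
    ξ n μ ∈ Metric.closedBall (0 : ℂ) 1 :=
  Metric.ball_subset_closedBall (h.mem_disk n μ hμ)

theorem fixed_of_tendsto (h : IsApproxFixed φ r ξ) (hφ : IsSchur₂ φ) {μ a : ℂ} (hμ : μ ∈ disk)
    (ha : a ∈ disk) (hlim : Tendsto (fun n => ξ n μ) atTop (𝓝 a)) : φ (a, μ) = a := by
  have hc := (hφ.slice hμ).differentiableOn.continuousOn.continuousAt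
    (Metric.isOpen_ball.mem_nhds ha)
  have h1 := ((Complex.continuous_ofReal.tendsto 1).comp h.tendsto_one).mul
    (hc.tendsto.comp hlim)
  have h2 := tendsto_nhds_unique (h1.congr fun n => h.scaled_eq n μ hμ) hlim
  simpa [_root_.slice] using h2

/-- Limits on the unit circle do not depend on the parameter. -/
theorem limit_eq (h : IsApproxFixed φ r ξ) {μ ν a b : ℂ} (hμ : μ ∈ disk) (hν : ν ∈ disk)
    (ha : Tendsto (fun n => ξ n μ) atTop (𝓝 a)) (hb : Tendsto (fun n => ξ n ν) atTop (𝓝 b))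
    (hna : ‖a‖ = 1) : a = b := by
  have h1 := le_of_tendsto_of_tendsto'
    (((ha.sub hb).norm.pow 2).mul_const ((1 - ‖μ‖ ^ 2) * (1 - ‖ν‖ ^ 2)))
    (((((ha.norm.pow 2).const_sub 1).mul ((hb.norm.pow 2).const_sub 1)).const_mul
      (‖μ - ν‖ ^ 2))) fun n => (h.isSchur n).schwarz_pick hμ hν
  have hK := mul_pos (one_sub_normSq_pos hμ) (one_sub_normSq_pos hν)
  -- The factor `1 - |a|²` kills the right side of the limiting Schwarz-Pick inequality.
  simp only [hna, one_pow, sub_self, zero_mul, mul_zero] at h1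
  have h2 : ‖a - b‖ ^ 2 ≤ 0 := by
    by_contra! hpos
    exact (mul_pos hpos hK).not_ge h1
  have h5 : ‖a - b‖ = 0 := pow_eq_zero_iff two_ne_zero |>.1 (le_antisymm h2 (sq_nonneg _))
  exact sub_eq_zero.1 (norm_eq_zero.1 h5)

/-- The Julia inequality at a limit point on the unit circle. -/
theorem julia (h : IsApproxFixed φ r ξ) (hφ : IsSchur₂ φ) {μ τ : ℂ} (hμ : μ ∈ disk)
    (hlim : Tendsto (fun n => ξ n μ) atTop (𝓝 τ)) {z : ℂ} (hz : z ∈ disk) :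
    ‖τ - slice φ μ z‖ ^ 2 * (1 - ‖z‖ ^ 2) ≤ ‖τ - z‖ ^ 2 * (1 - ‖slice φ μ z‖ ^ 2) := by
  have hS := hφ.slice hμ
  have hle : ∀ n, ‖slice φ μ (ξ n μ)‖ ≤ 1 := fun n => hS.norm_le_one _ (h.mem_disk n μ hμ)
  have heq : ∀ n, r n * slice φ μ (ξ n μ) = ξ n μ := fun n => h.scaled_eq n μ hμ
  have hlim' : Tendsto (fun n => slice φ μ (ξ n μ)) atTop (𝓝 τ) := by
    have h1 : Tendsto (fun n => slice φ μ (ξ n μ) - ξ n μ) atTop (𝓝 0) := by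
      refine squeeze_zero_norm (a := fun n => 1 - r n) (fun n => ?_)
        (by simpa using h.tendsto_one.const_sub 1)
      have h2 : slice φ μ (ξ n μ) - ξ n μ = ((1 - r n : ℝ) : ℂ) * slice φ μ (ξ n μ) := by
        conv_lhs => rw [← heq n, heq n]
        push_cast
        rw [sub_mul, heq n, one_mul]
      have h3 : 0 ≤ 1 - r n := sub_nonneg.2 (h.mem_Ioo n).2.le
      rw [h2, norm_mul, Complex.norm_of_nonneg h3]
      exact mul_le_of_le_one_right h3 (hle n)
    simpa using h1.add hlim
  refine le_of_tendsto_of_tendsto' (((hlim'.sub_const _).norm.pow 2).mul_const _)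
    (((hlim.sub_const z).norm.pow 2).mul_const _) fun n => ?_
  have hsp := hS.schwarz_pick (h.mem_disk n μ hμ) hz
  have hw := one_sub_normSq_pos (h.mem_disk n μ hμ)
  -- This gives `1 - |φ_μ(ξ)|² ≤ 1 - |ξ|²`, so the factor that degenerates at the circle cancels
  -- before the limit is taken.
  have hn : ‖ξ n μ‖ ≤ ‖slice φ μ (ξ n μ)‖ := by
    conv_lhs => rw [← heq n]
    rw [norm_mul, Complex.norm_of_nonneg (h.mem_Ioo n).1.le]
    exact mul_le_of_le_one_left (norm_nonneg _) (h.mem_Ioo n).2.le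
  have hz1 : 0 ≤ 1 - ‖slice φ μ z‖ ^ 2 :=
    sub_nonneg.2 (pow_le_one₀ (norm_nonneg _) (hS.norm_le_one z hz))
  have h6 : ‖ξ n μ - z‖ ^ 2 * ((1 - ‖slice φ μ (ξ n μ)‖ ^ 2) * (1 - ‖slice φ μ z‖ ^ 2)) ≤
      ‖ξ n μ - z‖ ^ 2 * ((1 - ‖ξ n μ‖ ^ 2) * (1 - ‖slice φ μ z‖ ^ 2)) := by gcongr
  refine le_of_mul_le_mul_left ?_ hw
  linarith

end IsApproxFixed

/-! ### The dichotomy. -/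

theorem IsSchur₂.fixed_unique {φ : ℂ × ℂ → ℂ} (hφ : IsSchur₂ φ) (hne : ¬ IsProjFst φ)
    {μ a b : ℂ} (hμ : μ ∈ disk) (ha : a ∈ disk) (hb : b ∈ disk) (hfa : φ (a, μ) = a)
    (hfb : φ (b, μ) = b) : a = b := by
  by_contra hab
  have hS := hφ.slice hμ
  have hm : MapsTo (_root_.slice φ μ) disk disk := by
    refine hS.mapsTo_or_const.resolve_right ?_
    rintro ⟨τ, hτ, h⟩
    have h1 : a = τ := hfa.symm.trans (h a ha)
    rw [mem_disk, h1, hτ] at ha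
    exact lt_irrefl _ ha
  exact hne (hφ.isProjFst_of_slice_eq_id hμ fun l hl =>
    eqOn_id_of_two_fixed hS.differentiableOn hm ha hb hab hfa hfb hl)

theorem IsSchur₂.isLeftTypeII_of_fixed {φ : ℂ × ℂ → ℂ} (hφ : IsSchur₂ φ) (hne : ¬ IsProjFst φ)
    {μ₀ l₀ : ℂ} (hμ₀ : μ₀ ∈ disk) (hl₀ : l₀ ∈ disk) (hfix : φ (l₀, μ₀) = l₀) :
    IsLeftTypeII φ := by
  obtain ⟨r, ξ, h⟩ := hφ.exists_isApproxFixed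
  have hbd : ∀ n, ξ n μ₀ ∈ Metric.closedBall (0 : ℂ) ‖l₀‖ := by
    intro n
    rw [mem_closedBall_zero_iff]
    exact (hφ.slice hμ₀).norm_scaled_fixed_le hl₀ hfix (h.mem_disk n μ₀ hμ₀) (h.mem_Ioo n).1
      (h.mem_Ioo n).2 (h.scaled_eq n μ₀ hμ₀)
  have hlimit : ∀ μ ∈ disk, ∀ a ∈ Metric.closedBall (0 : ℂ) 1, ∀ ψ : ℕ → ℕ, StrictMono ψ →
      Tendsto (fun n => ξ (ψ n) μ) atTop (𝓝 a) → a ∈ disk ∧ φ (a, μ) = a := by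
    intro μ hμ a ha ψ hψ hlim
    have had : a ∈ disk := by
      by_contra hd
      have hna : ‖a‖ = 1 := le_antisymm (by simpa using ha) (by simpa [disk] using hd)
      obtain ⟨b, hb, χ, hχ, hlim'⟩ := (isCompact_closedBall (0 : ℂ) ‖l₀‖).tendsto_subseq
        fun n => hbd (ψ n)
      -- A limit on the circle at `μ` would also be the limit at `μ₀`, which has modulus at most
      -- `|l₀| < 1`.
      have hab := (h.comp (hψ.comp hχ)).limit_eq hμ hμ₀ (hlim.comp hχ.tendsto_atTop) hlim' hna
      rw [← hab, mem_closedBall_zero_iff, hna] at hb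
      exact hb.not_gt (mem_disk.1 hl₀)
    exact ⟨had, (h.comp hψ).fixed_of_tendsto hφ hμ had hlim⟩
  have hex : ∀ μ ∈ disk, ∃ l ∈ disk, φ (l, μ) = l := by
    intro μ hμ
    obtain ⟨a, ha, ψ, hψ, hlim⟩ :=
      (isCompact_closedBall (0 : ℂ) 1).tendsto_subseq (h.mem_closedBall hμ)
    exact ⟨a, hlimit μ hμ a ha ψ hψ hlim⟩
  choose! η hη hηfix using hex
  have hη' : IsSchur η := by
    refine isSchur_of_tendsto h.isSchur fun μ hμ => ?_
    refine (isCompact_closedBall (0 : ℂ) 1).tendsto_of_subseq_unique (h.mem_closedBall hμ)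
      fun a ha ψ hψ hlim => ?_
    obtain ⟨had, hfa⟩ := hlimit μ hμ a ha ψ hψ hlim
    exact hφ.fixed_unique hne hμ had (hη μ hμ) hfa (hηfix μ hμ)
  refine ⟨hne, η, hη'.differentiableOn, hη, fun l hl μ hμ => ⟨fun hfl => ?_, fun hl => ?_⟩⟩
  · exact hφ.fixed_unique hne hμ (hη μ hμ) hl (hηfix μ hμ) hfl
  · rw [← hl]
    exact hηfix μ hμ

theorem IsSchur₂.isLeftTypeI_of_not_fixed {φ : ℂ × ℂ → ℂ} (hφ : IsSchur₂ φ)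
    (hne : ¬ IsProjFst φ) (hfix : ∀ μ ∈ disk, ∀ l ∈ disk, φ (l, μ) ≠ l) :
    IsLeftTypeI φ := by
  refine ⟨hne, ?_⟩
  by_cases hm : ∀ μ ∈ disk, MapsTo (_root_.slice φ μ) disk disk
  · obtain ⟨r, ξ, h⟩ := hφ.exists_isApproxFixed
    obtain ⟨τ, hτ, ψ, hψ, hlim⟩ :=
      (isCompact_closedBall (0 : ℂ) 1).tendsto_subseq (h.mem_closedBall zero_mem_disk)
    have hs := h.comp hψ
    have hτd : τ ∉ disk := fun hd =>
      hfix 0 zero_mem_disk τ hd (hs.fixed_of_tendsto hφ zero_mem_disk hd hlim)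
    have hnτ : ‖τ‖ = 1 := le_antisymm (by simpa using hτ) (by simpa [disk] using hτd)
    refine ⟨τ, hnτ, fun μ hμ => ?_⟩
    have hlimμ : Tendsto (fun n => (ξ ∘ ψ) n μ) atTop (𝓝 τ) :=
      (isCompact_closedBall (0 : ℂ) 1).tendsto_of_subseq_unique (hs.mem_closedBall hμ)
        fun a ha χ hχ hlim' => ((hs.comp hχ).limit_eq zero_mem_disk hμ
          (hlim.comp hχ.tendsto_atTop) hlim' hnτ).symm
    exact isBoundaryDenjoyWolffPoint_of_julia (hφ.slice hμ).differentiableOn (hm μ hμ)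
      (fun z hz => hfix μ hμ z hz) hnτ fun z hz => hs.julia hφ hμ hlimμ hz
  · push Not at hm
    obtain ⟨μ₀, hμ₀, hm⟩ := hm
    obtain ⟨τ, hτ, hc⟩ := (hφ.slice hμ₀).mapsTo_or_const.resolve_left hm
    refine ⟨τ, hτ, fun μ hμ => ⟨hτ, Or.inr fun z hz => ?_⟩⟩
    -- One slice is a unimodular constant; the maximum principle in `μ`, for each fixed `z`, spreads
    -- it to all slices.
    have hz0 : φ (z, μ₀) = τ := hc z hz
    have := (hφ.slice_fst hz).eqOn_const hμ₀ (by simp only [hz0, hτ]) hμ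
    exact this.trans hz0

theorem not_isLeftTypeI_and_isLeftTypeII {φ : ℂ × ℂ → ℂ} (h1 : IsLeftTypeI φ)
    (h2 : IsLeftTypeII φ) : False := by
  obtain ⟨-, τ, hτ, hI⟩ := h1
  obtain ⟨-, ξ, -, hξ, hII⟩ := h2
  have hd := hξ zero_mem_disk
  have hf := (hII _ hd 0 zero_mem_disk).2 rfl
  rcases (hI 0 zero_mem_disk).2 with ⟨-, hfix, -⟩ | hc
  · exact hfix _ hd hf
  · rw [hc _ hd] at hf
    rw [mem_disk, ← hf, hτ] at hd
    exact lt_irrefl _ hd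

theorem IsSchur₂.xor_isLeftType {φ : ℂ × ℂ → ℂ} (hφ : IsSchur₂ φ) (hne : ¬ IsProjFst φ) :
    Xor (IsLeftTypeI φ) (IsLeftTypeII φ) := by
  by_cases h : ∃ μ ∈ disk, ∃ l ∈ disk, φ (l, μ) = l
  · obtain ⟨μ, hμ, l, hl, hfl⟩ := h
    have h2 := hφ.isLeftTypeII_of_fixed hne hμ hl hfl
    exact Or.inr ⟨h2, fun h1 => not_isLeftTypeI_and_isLeftTypeII h1 h2⟩
  · push Not at h
    have h1 := hφ.isLeftTypeI_of_not_fixed hne h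
    exact Or.inl ⟨h1, fun h2 => not_isLeftTypeI_and_isLeftTypeII h1 h2⟩

theorem theorem4p3 (φ : ℂ × ℂ → ℂ) (hφ : IsSchur₂ φ) :
    (¬ IsProjFst φ → Xor (IsLeftTypeI φ) (IsLeftTypeII φ)) ∧
      (¬ IsProjSnd φ → Xor (IsRightTypeI φ) (IsRightTypeII φ)) :=
  ⟨hφ.xor_isLeftType, fun h => hφ.swapArgs.xor_isLeftType fun h' => h (isProjFst_swapArgs.1 h')⟩
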